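/- Consider the three-state Grover walk on $\mathbb Z$, with state space spanned by the orthonormal kets $|m,c\rangle$, $m\in\mathbb Z$, $c\in\{L,S,R\}$, and one-step evolution $U=S\,(I\otimes G)$, where $$G=\frac13\begin{pmatrix}-1&2&2\\2&-1&2\\2&2&-1\end{pmatrix}$$ acts on the coin and $S$ maps $|m,L\rangle\mapsto|m-1,L\rangle$, $|m,S\rangle\mapsto|m,S\rangle$, $|m,R\rangle\mapsto|m+1,R\rangle$. For $n\in\mathbb Z$ let $\Pi^n_{yes}=|n\rangle\langle n|\otimes I$ and $\Pi^n_{no}=I-\Pi^n_{yes}$. For $N\ge 1$ start in $|0,R\rangle$ and repeat the following step until a measurement answers "yes": apply $U$, then measure whether the walker is at $-1$, then whether it is at $N$. Let $$p_N=P_{-1,0,N}(0,0,1)=\sum_{t=1}^{\infty}\bigl\|\Pi^{-1}_{yes}U(\Pi^N_{no}\Pi^{-1}_{no}U)^{t-1}|0,R\rangle\bigr\|^2$$ be the probability that the walker is eventually absorbed at the left boundary $-1$. For $N=0$ the walker starts on the right boundary and counts as absorbed there at time $0$, that is, the initial state $|0,R\rangle$ in the formula is replaced by $\Pi^0_{no}\Pi^{-1}_{no}|0,R\rangle$.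 Then the series defining $p_N$ converges for every $N\ge 0$, and $$p_0=0,\qquad p_{N+1}=\frac{2+3p_N}{3+4p_N}\quad\text{for all } N\ge 0.$$ Consequently $p_N\to 1/\sqrt2$ as $N\to\infty$. -/

import Mathlib

noncomputable section

namespace GroverWalk

/-- States of the walker: the complex span of the kets `|m, c⟩`, with `m : ℤ` the position and
`c : Fin 3` the coin state, where `0`, `1`, `2` stand for `L`, `S`, `R`.  Every state that occurs in
the process started at one site is a finite superposition of kets. -/
abbrev State : Type := (ℤ × Fin 3) →₀ ℂ

/-- The basis state `|m, c⟩`. -/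
def ket (m : ℤ) (c : Fin 3) : State := Finsupp.single (m, c) 1

/-- The squared norm, for which the kets are orthonormal. -/
def normSq (ψ : State) : ℝ := ψ.sum fun _ a => ‖a‖ ^ 2

/-- The Grover operator on the coin space. -/
def groverMatrix : Matrix (Fin 3) (Fin 3) ℂ :=
  (1 / 3 : ℂ) • !![-1, 2, 2; 2, -1, 2; 2, 2, -1]

/-- The operator `I ⊗ G`. -/
def coinOp : State →ₗ[ℂ] State :=
  Finsupp.linearCombination ℂ fun x : ℤ × Fin 3 => ∑ c, groverMatrix c x.2 • ket x.1 c

/-- The displacement that each coin state causes: `L` moves left, `S` stays, `R` moves right. -/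
def displacement : Fin 3 → ℤ := ![-1, 0, 1]

/-- The position shift operator. -/
def shiftOp : State →ₗ[ℂ] State :=
  Finsupp.linearCombination ℂ fun x : ℤ × Fin 3 => ket (x.1 + displacement x.2) x.2

/-- The evolution operator of one step of the Grover walk on the line. -/
def evolution : State →ₗ[ℂ] State := shiftOp ∘ₗ coinOp

/-- The projection `|n⟩⟨n| ⊗ I`: the walker is found at position `n`. -/
def projYes (n : ℤ) : State →ₗ[ℂ] State :=
  Finsupp.linearCombination ℂ fun x : ℤ × Fin 3 => if x.1 = n then ket x.1 x.2 else 0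

/-- The complementary projection: the walker is not found at position `n`. -/
def projNo (n : ℤ) : State →ₗ[ℂ] State := LinearMap.id - projYes n

/-- Both boundary measurements, at `-M` and then at `N`, are answered "no". -/
def survive (M N : ℕ) : State →ₗ[ℂ] State := projNo (N : ℤ) ∘ₗ projNo (-(M : ℤ))

/-- The initial state `α|0,L⟩ + β|0,S⟩ + γ|0,R⟩`. -/
def initial (α β γ : ℂ) : State := α • ket 0 0 + β • ket 0 1 + γ • ket 0 2

/-- The (unnormalized) state of the walker not yet absorbed after `t` steps, for absorbing
boundaries at `-M` and `N`.  A walker whose starting site is itself a boundary counts as absorbed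
there at time `0`; for `M, N ≥ 1` this does not touch the initial state, see `survive_initial`. -/
def unabsorbed (M N : ℕ) (α β γ : ℂ) : ℕ → State
  | 0 => survive M N (initial α β γ)
  | t + 1 => survive M N (evolution (unabsorbed M N α β γ t))

/-- The probability that the measurement at `-M` is answered "yes" in step `t + 1`, no measurement
having been answered "yes" before. -/
def leftHitProb (M N : ℕ) (α β γ : ℂ) (t : ℕ) : ℝ :=
  normSq (projYes (-(M : ℤ)) (evolution (unabsorbed M N α β γ t)))

/-- The left absorbing probability: the probability that the measurement at `-M` is eventually
answered "yes", when the walk starts in `α|0,L⟩ + β|0,S⟩ + γ|0,R⟩` and has absorbing boundaries at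
`-M` and `N`. -/
def leftAbsorbProb (M N : ℕ) (α β γ : ℂ) : ℝ := ∑' t, leftHitProb M N α β γ t

theorem survive_initial (M N : ℕ) (hM : 0 < M) (hN : 0 < N) (α β γ : ℂ) :
    survive M N (initial α β γ) = initial α β γ := by
  have hM' : M ≠ 0 := hM.ne'
  have hN' : (0 : ℤ) ≠ N := by exact_mod_cast hN.ne
  simp [survive, initial, projNo, projYes, ket, hM', hN']

/-- For genuine boundaries the probabilities are those of the process that starts in the initial
state and, in each step, evolves and is then measured at `-M` and at `N`. -/
theorem leftHitProb_eq (M N : ℕ) (hM : 0 < M) (hN : 0 < N) (α β γ : ℂ) (t : ℕ) :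
    leftHitProb M N α β γ t =
      normSq (projYes (-(M : ℤ))
        (evolution (((survive M N ∘ₗ evolution) ^ t) (initial α β γ)))) := by
  have h : ∀ t, unabsorbed M N α β γ t = ((survive M N ∘ₗ evolution) ^ t) (initial α β γ) := by
    intro t
    induction t with
    | zero => simp [unabsorbed, survive_initial M N hM hN]
    | succ t ih => simp [unabsorbed, ih, pow_succ']
  rw [leftHitProb, h]

end GroverWalk

end

noncomputable section
namespace GroverWalk

theorem coinOp_apply (ψ : State) (m : ℤ) (c : Fin 3) :
    coinOp ψ (m, c) = ∑ d, groverMatrix c d * ψ (m, d) := by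
  induction ψ using Finsupp.induction_linear with
  | zero => simp
  | add f g hf hg => simp [hf, hg, mul_add, Finset.sum_add_distrib]
  | single x a =>
    obtain ⟨n, d⟩ := x
    by_cases h : n = m
    · subst h
      simp [coinOp, ket, Finsupp.single_apply, mul_comm]
    · simp [coinOp, ket, h]

theorem shiftOp_apply (ψ : State) (m : ℤ) (c : Fin 3) :
    shiftOp ψ (m, c) = ψ (m - displacement c, c) := by
  induction ψ using Finsupp.induction_linear with
  | zero => simp
  | add f g hf hg => simp [hf, hg]
  | single x a =>
    obtain ⟨n, d⟩ := x
    by_cases h : d = c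
    · subst h
      simp [shiftOp, ket, Finsupp.single_apply, eq_sub_iff_add_eq]
    · simp [shiftOp, ket, h]

theorem evolution_apply (ψ : State) (m : ℤ) (c : Fin 3) :
    evolution ψ (m, c) = ∑ d, groverMatrix c d * ψ (m - displacement c, d) := by
  simp [evolution, shiftOp_apply, coinOp_apply]

theorem projYes_apply (n : ℤ) (ψ : State) (x : ℤ × Fin 3) :
    projYes n ψ x = if x.1 = n then ψ x else 0 := by
  induction ψ using Finsupp.induction_linear with
  | zero => simp
  | add f g hf hg => simp only [map_add, Finsupp.add_apply, hf, hg]; split_ifs <;> simp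
  | single y a =>
    by_cases h : y = x
    · subst h
      by_cases h' : y.1 = n <;> simp [projYes, ket, h']
    · by_cases h' : y.1 = n <;> simp [projYes, ket, h', h]

theorem projNo_apply (n : ℤ) (ψ : State) (x : ℤ × Fin 3) :
    projNo n ψ x = if x.1 = n then 0 else ψ x := by
  simp only [projNo, LinearMap.sub_apply, LinearMap.id_apply, Finsupp.sub_apply, projYes_apply]
  split_ifs <;> simp

theorem survive_apply (M N : ℕ) (ψ : State) (x : ℤ × Fin 3) :
    survive M N ψ x = if x.1 = N ∨ x.1 = -(M : ℤ) then 0 else ψ x := by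
  simp only [survive, LinearMap.comp_apply, projNo_apply]
  split_ifs <;> simp_all

theorem summable_norm_sq (ψ : State) : Summable fun x => ‖ψ x‖ ^ 2 :=
  summable_of_ne_finset_zero (s := ψ.support) fun x hx => by simp_all

theorem normSq_eq_tsum (ψ : State) : normSq ψ = ∑' x, ‖ψ x‖ ^ 2 :=
  (tsum_eq_sum fun x hx => by simp_all).symm

theorem normSq_nonneg (ψ : State) : 0 ≤ normSq ψ := by
  rw [normSq_eq_tsum]; positivity

theorem normSq_shiftOp (ψ : State) : normSq (shiftOp ψ) = normSq ψ := by
  let e : ℤ × Fin 3 ≃ ℤ × Fin 3 :=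
    { toFun := fun x => (x.1 - displacement x.2, x.2)
      invFun := fun x => (x.1 + displacement x.2, x.2)
      left_inv := fun x => by simp
      right_inv := fun x => by simp }
  rw [normSq_eq_tsum, normSq_eq_tsum, ← e.tsum_eq fun x => ‖ψ x‖ ^ 2]
  exact tsum_congr fun x => congrArg (‖·‖ ^ 2) (shiftOp_apply ψ x.1 x.2)

theorem groverMatrix_norm_sq (x : Fin 3 → ℂ) :
    ∑ c, ‖∑ d, groverMatrix c d * x d‖ ^ 2 = ∑ c, ‖x c‖ ^ 2 := by
  simp only [groverMatrix, Fin.sum_univ_three, Complex.sq_norm, Complex.normSq_apply]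
  simp
  ring

theorem normSq_coinOp (ψ : State) : normSq (coinOp ψ) = normSq ψ := by
  rw [normSq_eq_tsum, normSq_eq_tsum, (summable_norm_sq _).tsum_prod,
    (summable_norm_sq _).tsum_prod]
  refine tsum_congr fun m => ?_
  simp only [tsum_fintype, coinOp_apply]
  exact groverMatrix_norm_sq fun d => ψ (m, d)

theorem normSq_evolution (ψ : State) : normSq (evolution ψ) = normSq ψ := by
  simp [evolution, normSq_shiftOp, normSq_coinOp]

theorem normSq_projYes_add_normSq_survive_le (M N : ℕ) (ψ : State) :
    normSq (projYes (-(M : ℤ)) ψ) + normSq (survive M N ψ) ≤ normSq ψ := by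
  simp only [normSq_eq_tsum]
  rw [← (summable_norm_sq _).tsum_add (summable_norm_sq _)]
  refine ((summable_norm_sq _).add (summable_norm_sq _)).tsum_le_tsum (fun x => ?_)
    (summable_norm_sq _)
  rw [projYes_apply, survive_apply]
  split_ifs <;> simp_all

/-- The left absorption probabilities are summable, by unitarity of the evolution. -/
theorem summable_leftHitProb (M N : ℕ) (α β γ : ℂ) : Summable (leftHitProb M N α β γ) := by
  refine summable_of_sum_range_le (c := normSq (unabsorbed M N α β γ 0))
    (fun t => normSq_nonneg _) fun n => ?_
  suffices h : ∑ t ∈ Finset.range n, leftHitProb M N α β γ t + normSq (unabsorbed M N α β γ n) ≤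
      normSq (unabsorbed M N α β γ 0) by
    linarith [normSq_nonneg (unabsorbed M N α β γ n)]
  induction n with
  | zero => simp
  | succ n ih =>
    have := normSq_projYes_add_normSq_survive_le M N (evolution (unabsorbed M N α β γ n))
    rw [normSq_evolution] at this
    rw [Finset.sum_range_succ]
    change _ + normSq (projYes (-(M : ℤ)) (evolution (unabsorbed M N α β γ n))) +
      normSq (survive M N (evolution (unabsorbed M N α β γ n))) ≤ _
    linarith

open Polynomial in
/-- Numerator and denominator of the generating function of the amplitudes of absorption at the
left boundary, for `N` sites between the boundaries. -/
def reflection : ℕ → ℝ[X] × ℝ[X]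
  | 0 => (0, 1)
  | N + 1 =>
    (X * (2 * (1 + X) * (reflection N).2 - X * (1 + 3 * X) * (reflection N).1),
      (3 + X) * (reflection N).2 - 2 * X * (1 + X) * (reflection N).1)

theorem coeff_zero_reflection (N : ℕ) : (reflection N).2.coeff 0 = 3 ^ N := by
  induction N with
  | zero => simp [reflection]
  | succ N ih => simp [reflection, Polynomial.mul_coeff_zero, ih, pow_succ']

open Polynomial in
/-- Numerators of the generating functions of the amplitudes at the site `m` that has `k` sites
between itself and the right boundary; their common denominator is `(reflection (m + k + 1)).2`. -/
def siteNumerator (m k : ℕ) : Fin 3 → ℝ[X] :=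
  ![(X * (X - 1)) ^ (m + 1) * (reflection k).1,
    (X * (X - 1)) ^ m * (2 * X * ((reflection k).2 - X * (reflection k).1)),
    (X * (X - 1)) ^ m * (reflection (k + 1)).2]

/-- Generating functions of the amplitudes at the site `m` that has `k` sites between itself and
the right boundary. -/
def siteSeries (m k : ℕ) (c : Fin 3) : PowerSeries ℝ :=
  siteNumerator m k c * ((reflection (m + k + 1)).2 : PowerSeries ℝ)⁻¹

/-- The generating function of the amplitudes of absorption at the left boundary. -/
def reflectionSeries (N : ℕ) : PowerSeries ℝ :=
  (reflection N).1 * ((reflection N).2 : PowerSeries ℝ)⁻¹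

theorem constantCoeff_reflection_ne_zero (N : ℕ) :
    PowerSeries.constantCoeff ((reflection N).2 : PowerSeries ℝ) ≠ 0 := by
  rw [← PowerSeries.coeff_zero_eq_constantCoeff_apply, Polynomial.coeff_coe,
    coeff_zero_reflection]
  positivity

theorem reflection_mul_reflectionSeries (N : ℕ) :
    ((reflection N).2 : PowerSeries ℝ) * reflectionSeries N = (reflection N).1 := by
  rw [reflectionSeries, mul_left_comm,
    PowerSeries.mul_inv_cancel _ (constantCoeff_reflection_ne_zero N), mul_one]

theorem coeff_succ_mul_of_eq {A B₀ B₁ B₂ : Polynomial ℝ} {x y z : ℝ} (q : PowerSeries ℝ)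
    (h : 3 * A = Polynomial.X * (Polynomial.C x * B₀ + Polynomial.C y * B₁ + Polynomial.C z * B₂))
    (t : ℕ) :
    ((A : PowerSeries ℝ) * q).coeff (t + 1) = 1 / 3 * (x * ((B₀ : PowerSeries ℝ) * q).coeff t +
      y * ((B₁ : PowerSeries ℝ) * q).coeff t + z * ((B₂ : PowerSeries ℝ) * q).coeff t) := by
  have h' : PowerSeries.C 3 * ((A : PowerSeries ℝ) * q) =
      PowerSeries.X * (PowerSeries.C x * ((B₀ : PowerSeries ℝ) * q) +
        PowerSeries.C y * ((B₁ : PowerSeries ℝ) * q) +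
        PowerSeries.C z * ((B₂ : PowerSeries ℝ) * q)) := by
    have := congrArg (fun p : Polynomial ℝ => (p : PowerSeries ℝ) * q) h
    simp only [Polynomial.coe_mul, Polynomial.coe_add, Polynomial.coe_C, Polynomial.coe_X] at this
    have h3 : ((3 : Polynomial ℝ) : PowerSeries ℝ) = PowerSeries.C 3 :=
      Polynomial.coe_C (3 : ℝ)
    rw [h3] at this
    linear_combination this
  have := congrArg (PowerSeries.coeff (t + 1)) h'
  simp only [PowerSeries.coeff_C_mul, PowerSeries.coeff_succ_X_mul, map_add] at this
  linarith

theorem siteNumerator_left (m k : ℕ) :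
    3 * siteNumerator m (k + 1) 0 = Polynomial.X * (Polynomial.C (-1) * siteNumerator (m + 1) k 0 +
      Polynomial.C 2 * siteNumerator (m + 1) k 1 + Polynomial.C 2 * siteNumerator (m + 1) k 2) := by
  simp [siteNumerator, reflection, show (Polynomial.C 2 : Polynomial ℝ) = 2 from rfl]
  ring

theorem siteNumerator_stay (m k : ℕ) :
    3 * siteNumerator m k 1 = Polynomial.X * (Polynomial.C 2 * siteNumerator m k 0 +
      Polynomial.C (-1) * siteNumerator m k 1 + Polynomial.C 2 * siteNumerator m k 2) := by
  simp [siteNumerator, reflection, show (Polynomial.C 2 : Polynomial ℝ) = 2 from rfl]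
  ring

theorem siteNumerator_right (m k : ℕ) :
    3 * siteNumerator (m + 1) k 2 = Polynomial.X * (Polynomial.C 2 * siteNumerator m (k + 1) 0 +
      Polynomial.C 2 * siteNumerator m (k + 1) 1 +
      Polynomial.C (-1) * siteNumerator m (k + 1) 2) := by
  simp [siteNumerator, reflection, show (Polynomial.C 2 : Polynomial ℝ) = 2 from rfl]
  ring

theorem reflection_eq_siteNumerator (k : ℕ) :
    3 * (reflection (k + 1)).1 = Polynomial.X * (Polynomial.C (-1) * siteNumerator 0 k 0 +
      Polynomial.C 2 * siteNumerator 0 k 1 + Polynomial.C 2 * siteNumerator 0 k 2) := by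
  simp [siteNumerator, reflection, show (Polynomial.C 2 : Polynomial ℝ) = 2 from rfl]
  ring

theorem evolution_left (ψ : State) (m : ℤ) : evolution ψ (m, 0) =
    1 / 3 * (-1 * ψ (m + 1, 0) + 2 * ψ (m + 1, 1) + 2 * ψ (m + 1, 2)) := by
  simp [evolution_apply, groverMatrix, displacement, Fin.sum_univ_three]
  ring

theorem evolution_stay (ψ : State) (m : ℤ) : evolution ψ (m, 1) =
    1 / 3 * (2 * ψ (m, 0) + -1 * ψ (m, 1) + 2 * ψ (m, 2)) := by
  simp [evolution_apply, groverMatrix, displacement, Fin.sum_univ_three]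
  ring

theorem evolution_right (ψ : State) (m : ℤ) : evolution ψ (m, 2) =
    1 / 3 * (2 * ψ (m - 1, 0) + 2 * ψ (m - 1, 1) + -1 * ψ (m - 1, 2)) := by
  simp [evolution_apply, groverMatrix, displacement, Fin.sum_univ_three]
  ring

theorem coeff_zero_siteSeries (m k : ℕ) (c : Fin 3) :
    (siteSeries m k c).coeff 0 = if m = 0 ∧ c = 2 then 1 else 0 := by
  have hq := PowerSeries.mul_inv_cancel _ (constantCoeff_reflection_ne_zero (m + k + 1))
  have hq' := congrArg PowerSeries.constantCoeff hq
  rw [map_mul, map_one] at hq'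
  fin_cases c <;> rcases m with _ | m <;>
    simp [siteSeries, siteNumerator, PowerSeries.coeff_zero_eq_constantCoeff_apply, pow_succ]
  rw [zero_add] at hq'
  simpa using hq'

theorem unabsorbed_apply (N t : ℕ) :
    (∀ m k : ℕ, m + k + 1 = N → ∀ c, unabsorbed 1 N 0 0 1 t ((m : ℤ), c) =
      ((siteSeries m k c).coeff t : ℂ)) ∧
    ∀ (x : ℤ) c, x < 0 ∨ (N : ℤ) ≤ x → unabsorbed 1 N 0 0 1 t (x, c) = 0 := by
  have hmk : ∀ m k : ℕ, ¬((m : ℤ) = ((m + k + 1 : ℕ) : ℤ) ∨ (m : ℤ) = -((1 : ℕ) : ℤ)) :=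
    fun m k => by rintro (h | h) <;> omega
  induction t with
  | zero =>
    constructor
    · rintro m k rfl c
      rw [unabsorbed, survive_apply, coeff_zero_siteSeries, if_neg (hmk m k)]
      by_cases hm : m = 0
      · subst hm
        fin_cases c <;> simp [initial, ket]
      · simp [initial, ket, hm]
    · intro x c hx
      rw [unabsorbed, survive_apply]
      split_ifs with h
      · rfl
      · have : (0 : ℤ) ≠ x := by push_cast at h; omega
        simp [initial, ket, this]
  | succ t ih =>
    obtain ⟨ih₁, ih₂⟩ := ih
    constructor
    · rintro m k rfl c
      rw [unabsorbed, survive_apply, if_neg (hmk m k)]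
      fin_cases c <;> simp only [Fin.zero_eta, Fin.mk_one, Fin.reduceFinMk]
      · rw [evolution_left]
        rcases k with _ | k
        · rw [ih₂ (m + 1) 0 (by simp), ih₂ (m + 1) 1 (by simp), ih₂ (m + 1) 2 (by simp)]
          simp [siteSeries, siteNumerator, reflection]
        · have e : (m : ℤ) + 1 = ((m + 1 : ℕ) : ℤ) := by push_cast; rfl
          rw [e, ih₁ (m + 1) k (by omega), ih₁ (m + 1) k (by omega), ih₁ (m + 1) k (by omega)]
          simp only [siteSeries]
          rw [coeff_succ_mul_of_eq _ (siteNumerator_left m k),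
            show m + 1 + k + 1 = m + (k + 1) + 1 by omega]
          push_cast
          ring
      · rw [evolution_stay, ih₁ m k rfl, ih₁ m k rfl, ih₁ m k rfl]
        simp only [siteSeries]
        rw [coeff_succ_mul_of_eq _ (siteNumerator_stay m k)]
        push_cast
        ring
      · rw [evolution_right]
        rcases m with _ | m
        · rw [ih₂ ((0 : ℕ) - 1) 0 (by simp), ih₂ ((0 : ℕ) - 1) 1 (by simp),
            ih₂ ((0 : ℕ) - 1) 2 (by simp)]
          have hq := PowerSeries.mul_inv_cancel _ (constantCoeff_reflection_ne_zero (0 + k + 1))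
          rw [zero_add] at hq
          simp [siteSeries, siteNumerator, hq, PowerSeries.coeff_one]
        · have e : ((m + 1 : ℕ) : ℤ) - 1 = m := by push_cast; ring
          rw [e, ih₁ m (k + 1) (by omega), ih₁ m (k + 1) (by omega), ih₁ m (k + 1) (by omega)]
          simp only [siteSeries]
          rw [coeff_succ_mul_of_eq _ (siteNumerator_right m k),
            show m + 1 + k + 1 = m + (k + 1) + 1 by omega]
          push_cast
          ring
    · intro x c hx
      rw [unabsorbed, survive_apply]
      split_ifs with h
      · rfl
      · have hx' : x < -1 ∨ (N : ℤ) < x := by push_cast at h; omega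
        rw [evolution_apply]
        refine Finset.sum_eq_zero fun d _ => ?_
        rw [ih₂ _ _ ?_, mul_zero]
        fin_cases c <;> simp [displacement] <;> omega

theorem normSq_projYes (n : ℤ) (ψ : State) :
    normSq (projYes n ψ) = ∑ c, ‖ψ (n, c)‖ ^ 2 := by
  rw [normSq_eq_tsum, (summable_norm_sq _).tsum_prod, tsum_eq_single n]
  · simp [tsum_fintype, projYes_apply]
  · intro m hm
    simp [projYes_apply, hm]

theorem leftHitProb_eq_coeff_sq (N t : ℕ) :
    leftHitProb 1 N 0 0 1 t = (reflectionSeries N).coeff (t + 1) ^ 2 := by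
  have key : ∀ a b c : ℝ, ‖(1 / 3 * (-1 * a + 2 * b + 2 * c) : ℂ)‖ ^ 2 =
      (1 / 3 * (-1 * a + 2 * b + 2 * c)) ^ 2 := fun a b c => by
    rw [← sq_abs (_ * _ : ℝ), ← Real.norm_eq_abs, ← Complex.norm_real]
    push_cast
    rfl
  obtain ⟨h₁, h₂⟩ := unabsorbed_apply N t
  rw [leftHitProb, normSq_projYes, Fin.sum_univ_three, evolution_stay, evolution_right,
    evolution_left]
  rw [h₂ (-((1 : ℕ) : ℤ)) 0 (by simp), h₂ (-((1 : ℕ) : ℤ)) 1 (by simp),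
    h₂ (-((1 : ℕ) : ℤ)) 2 (by simp), h₂ (-((1 : ℕ) : ℤ) - 1) 0 (by simp),
    h₂ (-((1 : ℕ) : ℤ) - 1) 1 (by simp), h₂ (-((1 : ℕ) : ℤ) - 1) 2 (by simp),
    show -((1 : ℕ) : ℤ) + 1 = ((0 : ℕ) : ℤ) by simp]
  rcases N with _ | N
  · rw [h₂ _ 0 (by simp), h₂ _ 1 (by simp), h₂ _ 2 (by simp)]
    simp [reflectionSeries, reflection]
  · rw [h₁ 0 N (by omega), h₁ 0 N (by omega), h₁ 0 N (by omega), reflectionSeries,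
      coeff_succ_mul_of_eq _ (reflection_eq_siteNumerator N)]
    simp only [siteSeries, zero_add]
    rw [key]
    simp

end GroverWalk
end

noncomputable section
open Filter Topology

/-- The sequence decays at least geometrically. -/
def GeometricDecay (a : ℕ → ℂ) : Prop :=
  ∃ r C : ℝ, 0 < r ∧ r < 1 ∧ 0 ≤ C ∧ ∀ t, ‖a t‖ ≤ C * r ^ t

theorem GeometricDecay.summable_norm {a : ℕ → ℂ} (h : GeometricDecay a) :
    Summable fun t => ‖a t‖ := by
  obtain ⟨r, C, hr, hr1, -, ha⟩ := h
  exact Summable.of_nonneg_of_le (fun _ => norm_nonneg _) ha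
    ((summable_geometric_of_lt_one hr.le hr1).mul_left C)

theorem GeometricDecay.of_finite {a : ℕ → ℂ} {n : ℕ} (h : ∀ t, n ≤ t → a t = 0) :
    GeometricDecay a := by
  refine ⟨1 / 2, ∑ t ∈ Finset.range n, ‖a t‖ * 2 ^ t, by norm_num, by norm_num, by positivity,
    fun t => ?_⟩
  by_cases ht : n ≤ t
  · rw [h t ht]; simp; positivity
  · have := Finset.single_le_sum (f := fun t => ‖a t‖ * 2 ^ t) (fun i _ => by positivity)
      (Finset.mem_range.2 (not_le.1 ht))
    calc ‖a t‖ = ‖a t‖ * 2 ^ t * (1 / 2) ^ t := by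
          rw [mul_assoc, ← mul_pow]; norm_num
      _ ≤ _ := by gcongr

/-- A null sequence inherits geometric decay from its image under a first order difference
operator. -/
theorem GeometricDecay.of_sub_mul {a h : ℕ → ℂ} {ζ : ℂ} (ha : Tendsto a atTop (𝓝 0))
    (hh : GeometricDecay h) (H : ∀ t, a t - ζ * a (t + 1) = h (t + 1)) : GeometricDecay a := by
  obtain ⟨r, C, hr, hr1, hC, hb⟩ := hh
  rcases le_or_gt ‖ζ‖ 1 with hζ | hζ
  · refine ⟨r, C / (1 - r), hr, hr1, div_nonneg hC (by linarith), fun t => ?_⟩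
    have key : ∀ n, ‖a t‖ ≤ ‖a (t + n)‖ + C * r ^ t * ((1 - r ^ n) / (1 - r)) := by
      intro n
      induction n with
      | zero => simp
      | succ n ih =>
        have e : a (t + n) = ζ * a (t + n + 1) + h (t + n + 1) := by rw [← H]; ring
        have h1 : ‖a (t + n)‖ ≤ ‖a (t + n + 1)‖ + C * r ^ (t + n) := by
          rw [e]
          refine (norm_add_le _ _).trans (add_le_add ?_ ((hb _).trans ?_))
          · rw [norm_mul]; exact mul_le_of_le_one_left (norm_nonneg _) hζ
          · exact mul_le_mul_of_nonneg_left
              (pow_le_pow_of_le_one hr.le hr1.le (Nat.le_succ _)) hC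
        have h2 : C * r ^ (t + n) + C * r ^ t * ((1 - r ^ n) / (1 - r)) =
            C * r ^ t * ((1 - r ^ (n + 1)) / (1 - r)) := by
          have : 1 - r ≠ 0 := by linarith
          field_simp
          ring
        rw [← h2, ← add_assoc t n 1]
        linarith
    have key' : ∀ n, ‖a t‖ ≤ ‖a (n + t)‖ + C / (1 - r) * r ^ t := fun n => by
      refine (key n).trans ?_
      rw [add_comm t n]
      refine add_le_add le_rfl ?_
      have : 0 ≤ r ^ n := by positivity
      have h3 : (1 - r ^ n) / (1 - r) ≤ 1 / (1 - r) := by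
        apply div_le_div_of_nonneg_right <;> linarith
      calc _ ≤ C * r ^ t * (1 / (1 - r)) := by gcongr
        _ = _ := by ring
    have hlim := (((tendsto_add_atTop_iff_nat t).2 ha).norm).add_const (C / (1 - r) * r ^ t)
    rw [norm_zero, zero_add] at hlim
    exact ge_of_tendsto' hlim key'
  · have hζ' : ‖ζ‖⁻¹ < 1 := inv_lt_one_of_one_lt₀ hζ
    have hζ0 : 0 < ‖ζ‖ := by linarith
    obtain ⟨s, hs, hs1⟩ := exists_between (max_lt hr1 hζ')
    have hrs : r < s := (le_max_left _ _).trans_lt hs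
    have hzs : ‖ζ‖⁻¹ < s := (le_max_right _ _).trans_lt hs
    have hs0 : 0 < s := hr.trans hrs
    have hzs' : 0 < ‖ζ‖ * s - 1 := by
      have := mul_lt_mul_of_pos_left hzs hζ0
      rw [mul_inv_cancel₀ hζ0.ne'] at this
      linarith
    refine ⟨s, ‖a 0‖ + C * s / (‖ζ‖ * s - 1), hs0, hs1, by positivity, fun t => ?_⟩
    induction t with
    | zero => simp; positivity
    | succ t ih =>
      set K := ‖a 0‖ + C * s / (‖ζ‖ * s - 1) with hK
      have e : ζ * a (t + 1) = a t - h (t + 1) := by rw [← H]; ring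
      have h1 : ‖ζ‖ * ‖a (t + 1)‖ ≤ K * s ^ t + C * s ^ (t + 1) := by
        rw [← norm_mul, e]
        refine (norm_sub_le _ _).trans (add_le_add ih ((hb _).trans ?_))
        gcongr
      have h2 : K + C * s ≤ ‖ζ‖ * s * K := by
        have : C * s ≤ (‖ζ‖ * s - 1) * K := by
          rw [hK, mul_add, mul_div_cancel₀ _ hzs'.ne']
          have := mul_nonneg hzs'.le (norm_nonneg (a 0))
          linarith
        linarith
      refine le_of_mul_le_mul_left (h1.trans ?_) hζ0
      calc K * s ^ t + C * s ^ (t + 1) = (K + C * s) * s ^ t := by ring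
        _ ≤ ‖ζ‖ * s * K * s ^ t := by gcongr
        _ = _ := by ring

/-- A null sequence whose generating function is rational decays geometrically. -/
theorem PowerSeries.geometricDecay_of_mul_eq (Q : Polynomial ℂ) (hQ : Q ≠ 0)
    (f : PowerSeries ℂ) (hf : Tendsto (fun t => f.coeff t) atTop (𝓝 0))
    (h : GeometricDecay fun t => (Q * f : PowerSeries ℂ).coeff t) :
    GeometricDecay fun t => f.coeff t := by
  induction hn : Q.natDegree generalizing Q f with
  | zero =>
    obtain ⟨c, rfl⟩ := Polynomial.natDegree_eq_zero.1 hn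
    have hc : c ≠ 0 := fun h => hQ (by simp [h])
    obtain ⟨r, C, hr, hr1, hC, hb⟩ := h
    refine ⟨r, ‖c‖⁻¹ * C, hr, hr1, by positivity, fun t => ?_⟩
    have := hb t
    simp only [Polynomial.coe_C, PowerSeries.coeff_C_mul, norm_mul] at this
    rw [mul_assoc, ← div_eq_inv_mul, le_div_iff₀' (by positivity)]
    exact this
  | succ n ih =>
    obtain ⟨ζ, hζ⟩ := IsAlgClosed.exists_root Q fun h0 => by
      rw [Polynomial.natDegree_eq_of_degree_eq_some h0] at hn; simp at hn
    obtain ⟨Q₁, rfl⟩ := Polynomial.dvd_iff_isRoot.2 hζ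
    have hQ₁ : Q₁ ≠ 0 := right_ne_zero_of_mul hQ
    set g : PowerSeries ℂ := (Polynomial.X - Polynomial.C ζ : Polynomial ℂ) * f with hg
    have hg1 : ∀ t, f.coeff t - ζ * f.coeff (t + 1) = g.coeff (t + 1) := fun t => by
      simp [hg, sub_mul, PowerSeries.coeff_succ_X_mul, PowerSeries.coeff_C_mul]
    have hg0 : Tendsto (fun t => g.coeff t) atTop (𝓝 0) := by
      rw [← tendsto_add_atTop_iff_nat 1]
      simp only [← hg1]
      simpa using hf.sub (((tendsto_add_atTop_iff_nat 1).2 hf).const_mul ζ)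
    refine .of_sub_mul hf (ih Q₁ hQ₁ g hg0 ?_ ?_) hg1
    · convert h using 3
      rw [hg, Polynomial.coe_mul]; ring
    · rw [Polynomial.natDegree_mul (Polynomial.X_sub_C_ne_zero ζ) hQ₁,
        Polynomial.natDegree_X_sub_C] at hn
      omega
end

noncomputable section
open Filter Topology

/-- The character `θ ↦ exp (i n θ)`. -/
def expChar (n : ℤ) (θ : ℝ) : ℂ := Complex.exp (θ * Complex.I) ^ n

theorem continuous_expChar (n : ℤ) : Continuous (expChar n) :=
  Continuous.zpow₀ (by fun_prop) n fun θ => Or.inl (Complex.exp_ne_zero _)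

theorem expChar_add (m n : ℤ) (θ : ℝ) : expChar (m + n) θ = expChar m θ * expChar n θ :=
  zpow_add₀ (Complex.exp_ne_zero _) m n

theorem norm_expChar (n : ℤ) (θ : ℝ) : ‖expChar n θ‖ = 1 := by
  simp [expChar, Complex.norm_exp_ofReal_mul_I]

theorem integral_expChar (n : ℤ) :
    ∫ θ in 0..2 * Real.pi, expChar n θ = if n = 0 then (2 * Real.pi : ℂ) else 0 := by
  split_ifs with h
  · simp [h, expChar]
  · have hn : (n * Complex.I : ℂ) ≠ 0 := by simp [h]
    have e : expChar n = fun θ : ℝ => Complex.exp (n * Complex.I * θ) := by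
      ext θ
      rw [expChar, ← Complex.exp_int_mul]
      ring_nf
    rw [e, integral_exp_mul_complex hn]
    have : (n * Complex.I * (2 * Real.pi : ℝ) : ℂ) = n * (2 * Real.pi * Complex.I) := by
      push_cast; ring
    rw [this, Complex.exp_int_mul_two_pi_mul_I]
    simp

variable {a : ℕ → ℝ}

/-- The Fourier series with coefficient `a t` at the frequency `s t`. -/
def fourierSum (a : ℕ → ℝ) (s : ℕ → ℤ) (θ : ℝ) : ℂ := ∑' t, (a t : ℂ) * expChar (s t) θ

theorem continuous_fourierSum (ha : Summable fun t => |a t|) (s : ℕ → ℤ) :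
    Continuous (fourierSum a s) :=
  continuous_tsum (fun t => continuous_const.mul (continuous_expChar _)) ha fun t θ => by
    simp [norm_expChar]

theorem integral_fourierSum_mul (ha : Summable fun t => |a t|) (s : ℕ → ℤ) {g : ℝ → ℂ}
    (hg : Continuous g) :
    ∫ θ in 0..2 * Real.pi, fourierSum a s θ * g θ =
      ∑' t, (a t : ℂ) * ∫ θ in 0..2 * Real.pi, expChar (s t) θ * g θ := by
  have hs : ∀ θ, Summable fun t => (a t : ℂ) * expChar (s t) θ := fun θ =>
    Summable.of_norm (by simpa [norm_expChar] using ha)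
  have h := intervalIntegral.hasSum_integral_of_dominated_convergence
    (μ := MeasureTheory.volume) (a := 0) (b := 2 * Real.pi)
    (F := fun t θ => (a t : ℂ) * expChar (s t) θ * g θ)
    (f := fun θ => fourierSum a s θ * g θ) (fun t θ => |a t| * ‖g θ‖)
    (fun t => ((continuous_const.mul (continuous_expChar _)).mul hg).aestronglyMeasurable)
    (fun t => .of_forall fun θ _ => by simp [norm_expChar])
    (.of_forall fun θ _ => ha.mul_right _)
    (by
      simp only [tsum_mul_right]
      exact (continuous_const.mul hg.norm).intervalIntegrable _ _)
    (.of_forall fun θ _ => (hs θ).hasSum.mul_right _)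
  rw [← h.tsum_eq]
  refine tsum_congr fun t => ?_
  rw [← intervalIntegral.integral_const_mul]
  simp only [mul_assoc]

theorem integral_fourierSum_mul_expChar (ha : Summable fun t => |a t|) (s : ℕ → ℤ) (n : ℤ) :
    ∫ θ in 0..2 * Real.pi, fourierSum a s θ * expChar n θ =
      ∑' t, if s t + n = 0 then (2 * Real.pi * a t : ℂ) else 0 := by
  rw [integral_fourierSum_mul ha s (continuous_expChar n)]
  refine tsum_congr fun t => ?_
  simp only [← expChar_add, integral_expChar]
  split_ifs <;> ring

theorem integral_fourierSum_natCast (ha : Summable fun t => |a t|) (j : ℕ) :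
    ∫ θ in 0..2 * Real.pi, fourierSum a (fun t => t) θ * expChar (-j) θ = 2 * Real.pi * a j := by
  rw [integral_fourierSum_mul_expChar ha, tsum_eq_single j]
  · simp
  · intro t ht
    rw [if_neg (by omega)]

theorem integral_fourierSum_neg (ha : Summable fun t => |a t|) (h0 : a 0 = 0) (j : ℕ) :
    ∫ θ in 0..2 * Real.pi, fourierSum a (fun t => -t) θ * expChar (-j) θ = 0 := by
  rw [integral_fourierSum_mul_expChar ha]
  refine (tsum_congr fun t => ?_).trans tsum_zero
  split_ifs with h
  · rw [show t = 0 by omega, h0]; simp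
  · rfl

/-- The autocorrelation of a sequence. -/
def autocorrelation (a : ℕ → ℝ) (j : ℕ) : ℝ := ∑' t, a t * a (t + j)

theorem integral_fourierSum_mul_fourierSum (ha : Summable fun t => |a t|) (j : ℕ) :
    ∫ θ in 0..2 * Real.pi, fourierSum a (fun t => -t) θ *
      (fourierSum a (fun t => t) θ * expChar (-j) θ) = 2 * Real.pi * autocorrelation a j := by
  rw [integral_fourierSum_mul ha _
      (Continuous.fun_mul (continuous_fourierSum ha _) (continuous_expChar _)),
    autocorrelation, Complex.ofReal_tsum, ← tsum_mul_left]
  refine tsum_congr fun t => ?_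
  have : ∀ θ, expChar (-(t : ℤ)) θ * (fourierSum a (fun t => t) θ * expChar (-j) θ) =
      fourierSum a (fun t => t) θ * expChar (-((t + j : ℕ) : ℤ)) θ := fun θ => by
    rw [show -((t + j : ℕ) : ℤ) = -(t : ℤ) + -j by push_cast; ring, expChar_add]
    ring
  simp only [this]
  rw [integral_fourierSum_natCast ha]
  push_cast
  ring

theorem integral_fourierSum_mul_fourierSum_one (ha : Summable fun t => |a t|) (h0 : a 0 = 0) :
    ∫ θ in 0..2 * Real.pi, fourierSum a (fun t => -t) θ *
      (fourierSum a (fun t => t) θ * expChar 1 θ) = 2 * Real.pi * autocorrelation a 1 := by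
  rw [integral_fourierSum_mul ha _
      (Continuous.fun_mul (continuous_fourierSum ha _) (continuous_expChar _)),
    autocorrelation, Complex.ofReal_tsum, ← tsum_mul_left]
  have key : ∀ t, ((a (t + 1) : ℂ) * ∫ θ in 0..2 * Real.pi, expChar (-((t + 1 : ℕ) : ℤ)) θ *
      (fourierSum a (fun t => t) θ * expChar 1 θ)) =
        2 * Real.pi * ((a t * a (t + 1) : ℝ) : ℂ) := fun t => by
    have : ∀ θ, expChar (-((t + 1 : ℕ) : ℤ)) θ * (fourierSum a (fun t => t) θ * expChar 1 θ) =
        fourierSum a (fun t => t) θ * expChar (-t) θ := fun θ => by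
      rw [show -(t : ℤ) = -((t + 1 : ℕ) : ℤ) + 1 by push_cast; ring, expChar_add]
      ring
    simp only [this]
    rw [integral_fourierSum_natCast ha]
    push_cast
    ring
  have hs : Summable fun t => (2 * Real.pi * ((a t * a (t + 1) : ℝ) : ℂ)) := by
    have hA : ∀ t, |a t| ≤ ∑' t, |a t| := fun t => ha.le_tsum t fun _ _ => abs_nonneg _
    refine Summable.mul_left _ (Complex.ofRealCLM.summable (Summable.of_norm_bounded
      (g := fun t => |a t| * ∑' t, |a t|) (ha.mul_right _) fun t => ?_))
    exact (abs_mul (a t) (a (t + 1))).le.trans (mul_le_mul_of_nonneg_left (hA _) (abs_nonneg _))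
  rw [Summable.tsum_eq_zero_add]
  · simp only [h0, Complex.ofReal_zero, zero_mul, zero_add]
    exact tsum_congr key
  · rw [← summable_nat_add_iff 1]
    exact hs.congr fun t => (key t).symm

theorem tendsto_autocorrelation (ha : Summable fun t => |a t|) :
    Tendsto (autocorrelation a) atTop (𝓝 0) := by
  have hA : ∀ t, |a t| ≤ ∑' t, |a t| := fun t => ha.le_tsum t fun _ _ => abs_nonneg _
  have h0 : Tendsto a atTop (𝓝 0) :=
    (tendsto_zero_iff_abs_tendsto_zero _).2 ha.tendsto_atTop_zero
  have := tendsto_tsum_of_dominated_convergence (𝓕 := atTop)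
    (f := fun j t => a t * a (t + j)) (g := fun _ => 0) (bound := fun t => |a t| * ∑' t, |a t|)
    (ha.mul_right _)
    (fun t => by
      have := (((tendsto_add_atTop_iff_nat t).2 h0).const_mul (a t))
      simpa [add_comm] using this)
    (.of_forall fun j t => by
      rw [Real.norm_eq_abs, abs_mul]
      exact mul_le_mul_of_nonneg_left (hA _) (abs_nonneg _))
  change Tendsto (fun j => ∑' t, a t * a (t + j)) atTop _
  simpa using this

/-- The Fourier coefficients of the identity `(3 cos θ - 1) |f|² = 2 Re f`. -/
theorem autocorrelation_recurrence (ha : Summable fun t => |a t|)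
    (h : ∀ᵐ θ : ℝ, (3 / 2 * (expChar 1 θ + expChar (-1) θ) - 1) *
      (fourierSum a (fun t => -t) θ * fourierSum a (fun t => t) θ) =
        fourierSum a (fun t => t) θ + fourierSum a (fun t => -t) θ) (n : ℤ) :
    3 / 2 * (∫ θ in 0..2 * Real.pi, fourierSum a (fun t => -t) θ *
        (fourierSum a (fun t => t) θ * expChar (n + 1) θ)) +
      3 / 2 * (∫ θ in 0..2 * Real.pi, fourierSum a (fun t => -t) θ *
        (fourierSum a (fun t => t) θ * expChar (n - 1) θ)) -
      (∫ θ in 0..2 * Real.pi, fourierSum a (fun t => -t) θ *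
        (fourierSum a (fun t => t) θ * expChar n θ)) =
    (∫ θ in 0..2 * Real.pi, fourierSum a (fun t => t) θ * expChar n θ) +
      ∫ θ in 0..2 * Real.pi, fourierSum a (fun t => -t) θ * expChar n θ := by
  have hc := continuous_fourierSum ha
  have hi₁ : ∀ n, IntervalIntegrable (fun θ => fourierSum a (fun t => -t) θ *
      (fourierSum a (fun t => t) θ * expChar n θ)) MeasureTheory.volume 0 (2 * Real.pi) := fun n =>
    ((hc _).mul ((hc _).mul (continuous_expChar n))).intervalIntegrable _ _
  have hi₂ : ∀ s : ℕ → ℤ, IntervalIntegrable (fun θ => fourierSum a s θ * expChar n θ)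
      MeasureTheory.volume 0 (2 * Real.pi) := fun s =>
    ((hc _).mul (continuous_expChar n)).intervalIntegrable _ _
  rw [← intervalIntegral.integral_const_mul, ← intervalIntegral.integral_const_mul,
    ← intervalIntegral.integral_add ((hi₁ _).const_mul _) ((hi₁ _).const_mul _),
    ← intervalIntegral.integral_sub (((hi₁ _).const_mul _).add ((hi₁ _).const_mul _)) (hi₁ _),
    ← intervalIntegral.integral_add (hi₂ _) (hi₂ _)]
  refine intervalIntegral.integral_congr_ae (h.mono fun θ hθ _ => ?_)
  rw [sub_eq_add_neg n 1, expChar_add, expChar_add]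
  linear_combination expChar n θ * hθ

theorem two_mul_tsum_eq (ha : Summable fun t => |a t|) (h0 : a 0 = 0)
    (h : ∀ᵐ θ : ℝ, (3 / 2 * (expChar 1 θ + expChar (-1) θ) - 1) *
      (fourierSum a (fun t => -t) θ * fourierSum a (fun t => t) θ) =
        fourierSum a (fun t => t) θ + fourierSum a (fun t => -t) θ)
    {z : ℂ} (hz : ‖z‖ = 1) (hz' : 3 * z ^ 2 - 2 * z + 3 = 0) :
    2 * ∑' t, (a t : ℂ) * z ^ t = (3 * z - 1) * autocorrelation a 0 := by
  have hπ : (2 * Real.pi : ℂ) ≠ 0 := by simp [Real.pi_ne_zero]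
  have h1 : (3 * autocorrelation a 1 : ℂ) = autocorrelation a 0 := by
    have e := autocorrelation_recurrence ha h 0
    have e0 := integral_fourierSum_mul_fourierSum ha 0
    have e1 := integral_fourierSum_mul_fourierSum ha 1
    have e2 := integral_fourierSum_mul_fourierSum_one ha h0
    have e3 := integral_fourierSum_natCast ha 0
    have e4 := integral_fourierSum_neg ha h0 0
    simp only [Nat.cast_zero, Nat.cast_one, neg_zero, zero_add, zero_sub] at e e0 e1 e2 e3 e4
    rw [e0, e1, e2, e3, e4, h0] at e
    refine mul_left_cancel₀ hπ ?_
    rw [Complex.ofReal_zero] at e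
    linear_combination e
  have h2 : ∀ j, (3 * autocorrelation a (j + 2) - 2 * autocorrelation a (j + 1) +
      3 * autocorrelation a j : ℂ) = 2 * a (j + 1) := fun j => by
    have e := autocorrelation_recurrence ha h (-((j + 1 : ℕ) : ℤ))
    have e0 := integral_fourierSum_mul_fourierSum ha j
    have e1 := integral_fourierSum_mul_fourierSum ha (j + 1)
    have e2 := integral_fourierSum_mul_fourierSum ha (j + 2)
    have e3 := integral_fourierSum_natCast ha (j + 1)
    have e4 := integral_fourierSum_neg ha h0 (j + 1)
    rw [show -((j + 1 : ℕ) : ℤ) + 1 = -j by push_cast; ring,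
      show -((j + 1 : ℕ) : ℤ) - 1 = -((j + 2 : ℕ) : ℤ) by push_cast; ring,
      e0, e1, e2, e3, e4] at e
    refine mul_left_cancel₀ hπ ?_
    linear_combination 2 * e
  have h3 : ∀ J, 2 * ∑ t ∈ Finset.range (J + 1), (a t : ℂ) * z ^ t =
      (3 * z - 1) * autocorrelation a 0 +
        z ^ J * (3 * autocorrelation a (J + 1) - 3 * z * autocorrelation a J) := fun J => by
    induction J with
    | zero => simp [h0]; linear_combination -h1
    | succ J ih =>
      rw [Finset.sum_range_succ, mul_add, ih]
      linear_combination -z ^ (J + 1) * h2 J + z ^ J * autocorrelation a (J + 1) * hz'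
  have hs : Summable fun t => (a t : ℂ) * z ^ t := Summable.of_norm (by simpa [hz] using ha)
  have l1 := ((tendsto_add_atTop_iff_nat 1).2 hs.hasSum.tendsto_sum_nat).const_mul 2
  have hr : Tendsto (fun J => (autocorrelation a J : ℂ)) atTop (𝓝 0) := by
    simpa [Function.comp_def] using
      (Complex.continuous_ofReal.tendsto 0).comp (tendsto_autocorrelation ha)
  have l2 : Tendsto (fun J => z ^ J * (3 * autocorrelation a (J + 1) -
      3 * z * autocorrelation a J : ℂ)) atTop (𝓝 0) := by
    have : Tendsto (fun J => (3 * autocorrelation a (J + 1) -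
      3 * z * autocorrelation a J : ℂ)) atTop (𝓝 0) := by
      simpa using (((tendsto_add_atTop_iff_nat 1).2 hr).const_mul 3).sub (hr.const_mul (3 * z))
    rw [tendsto_zero_iff_norm_tendsto_zero] at this ⊢
    simpa [hz] using this
  have l3 := l2.const_add ((3 * z - 1) * (autocorrelation a 0 : ℂ))
  rw [add_zero] at l3
  exact tendsto_nhds_unique l1 (l3.congr fun J => (h3 J).symm)
end

noncomputable section
open Filter Topology

theorem Polynomial.hasSum_aeval (Q : Polynomial ℝ) (z : ℂ) :
    HasSum (fun t => (Q.coeff t : ℂ) * z ^ t) (aeval z Q) := by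
  rw [Polynomial.aeval_eq_sum_range]
  simp only [Complex.real_smul]
  refine hasSum_sum_of_ne_finset_zero fun t ht => ?_
  rw [Polynomial.coeff_eq_zero_of_natDegree_lt (by simpa using ht)]
  simp

theorem aeval_mul_tsum_coeff {P Q : Polynomial ℝ} {f : PowerSeries ℝ}
    (hf : Summable fun t => |f.coeff t|) (h : (Q : PowerSeries ℝ) * f = P) {z : ℂ}
    (hz : ‖z‖ = 1) :
    Polynomial.aeval z Q * ∑' t, (f.coeff t : ℂ) * z ^ t = Polynomial.aeval z P := by
  rw [← (Q.hasSum_aeval z).tsum_eq, ← (P.hasSum_aeval z).tsum_eq,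
    tsum_mul_tsum_eq_tsum_sum_antidiagonal_of_summable_norm]
  · refine tsum_congr fun n => ?_
    rw [← Polynomial.coeff_coe, ← h, PowerSeries.coeff_mul, Complex.ofReal_sum, Finset.sum_mul]
    refine Finset.sum_congr rfl fun x hx => ?_
    rw [← Finset.HasAntidiagonal.mem_antidiagonal.1 hx, pow_add, Polynomial.coeff_coe]
    push_cast
    ring
  · exact (Q.hasSum_aeval z).summable.norm
  · simpa [hz] using hf

theorem summable_abs_coeff_of_mul_eq {P Q : Polynomial ℝ} (hQ : Q ≠ 0) {f : PowerSeries ℝ}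
    (hf : Tendsto (fun t => f.coeff t) atTop (𝓝 0)) (h : (Q : PowerSeries ℝ) * f = P) :
    Summable fun t => |f.coeff t| := by
  have := PowerSeries.geometricDecay_of_mul_eq (Q.map Complex.ofRealHom)
    ((Polynomial.map_ne_zero_iff Complex.ofRealHom.injective).2 hQ)
    (PowerSeries.map Complex.ofRealHom f)
    (by simpa [Function.comp_def] using (Complex.continuous_ofReal.tendsto 0).comp hf) ?_
  · simpa using this.summable_norm
  · rw [Polynomial.polynomial_map_coe, ← map_mul, h]
    refine .of_finite (n := P.natDegree + 1) fun t ht => ?_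
    rw [PowerSeries.coeff_map, Polynomial.coeff_coe,
      Polynomial.coeff_eq_zero_of_natDegree_lt (by omega), map_zero]

theorem ae_aeval_exp_ne_zero {Q : Polynomial ℝ} (hQ : Q ≠ 0) :
    ∀ᵐ θ : ℝ, Polynomial.aeval (Complex.exp (θ * Complex.I)) Q ≠ 0 := by
  have hc : {z : ℂ | Polynomial.aeval z Q = 0}.Countable := by
    refine (Q.rootSet_finite ℂ).countable.mono fun z hz => ?_
    exact (Polynomial.mem_rootSet_of_ne hQ).2 hz
  have h2 : {θ : ℝ | Polynomial.aeval (Complex.exp (θ * Complex.I)) Q = 0}.Countable :=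
    hc.preimage_cexp.preimage_of_injOn (f := fun θ : ℝ => (θ * Complex.I : ℂ))
      fun x _ y _ h => by simpa using h
  simpa using h2.ae_notMem MeasureTheory.volume

namespace GroverWalk

theorem reflection_energy (N : ℕ) {z z' : ℂ} (h : z * z' = 1) :
    (3 / 2 * (z + z') - 1) *
        (Polynomial.aeval z (reflection N).1 * Polynomial.aeval z' (reflection N).1) =
      Polynomial.aeval z (reflection N).1 * Polynomial.aeval z' (reflection N).2 +
        Polynomial.aeval z' (reflection N).1 * Polynomial.aeval z (reflection N).2 := by
  induction N with
  | zero => simp [reflection]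
  | succ N ih =>
    have hz : z ≠ 0 := left_ne_zero_of_mul_eq_one h
    obtain rfl : z' = z⁻¹ := eq_inv_of_mul_eq_one_right h
    simp only [reflection, map_mul, map_add, map_sub, map_one, Polynomial.aeval_X, map_ofNat]
    generalize Polynomial.aeval z (reflection N).1 = p at *
    generalize Polynomial.aeval z (reflection N).2 = q at *
    generalize Polynomial.aeval z⁻¹ (reflection N).1 = p' at *
    generalize Polynomial.aeval z⁻¹ (reflection N).2 = q' at *
    rw [← sub_eq_zero] at ih ⊢
    refine Eq.trans (b := (2 - z - z⁻¹) * ((3 / 2 * (z + z⁻¹) - 1) * (p * p') -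
      (p * q' + p' * q))) ?_ (by rw [ih, mul_zero])
    field_simp
    ring

theorem reflection_ne_zero (N : ℕ) : (reflection N).2 ≠ 0 := fun h => by
  have := coeff_zero_reflection N
  rw [h, Polynomial.coeff_zero] at this
  exact (pow_ne_zero N three_ne_zero) this.symm

theorem coeff_zero_reflectionSeries (N : ℕ) : (reflectionSeries N).coeff 0 = 0 := by
  rcases N with _ | N <;>
    simp [reflectionSeries, reflection, PowerSeries.coeff_zero_eq_constantCoeff_apply]

theorem tendsto_coeff_reflectionSeries (N : ℕ) :
    Tendsto (fun t => (reflectionSeries N).coeff t) atTop (𝓝 0) := by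
  have h := (summable_leftHitProb 1 N 0 0 1).tendsto_atTop_zero
  rw [funext (leftHitProb_eq_coeff_sq N)] at h
  rw [← tendsto_add_atTop_iff_nat 1, tendsto_zero_iff_abs_tendsto_zero]
  have := (Real.continuous_sqrt.tendsto 0).comp h
  simpa [Function.comp_def, Real.sqrt_sq_eq_abs] using this

theorem summable_abs_coeff_reflectionSeries (N : ℕ) :
    Summable fun t => |(reflectionSeries N).coeff t| :=
  summable_abs_coeff_of_mul_eq (reflection_ne_zero N) (tendsto_coeff_reflectionSeries N)
    (reflection_mul_reflectionSeries N)

theorem leftAbsorbProb_eq_autocorrelation (N : ℕ) :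
    leftAbsorbProb 1 N 0 0 1 = autocorrelation (fun t => (reflectionSeries N).coeff t) 0 := by
  have h := summable_leftHitProb 1 N 0 0 1
  rw [funext (leftHitProb_eq_coeff_sq N)] at h
  rw [leftAbsorbProb, autocorrelation, funext (leftHitProb_eq_coeff_sq N)]
  rw [Summable.tsum_eq_zero_add (f := fun t => _ * (reflectionSeries N).coeff (t + 0))]
  · simp [coeff_zero_reflectionSeries, sq]
  · rw [← summable_nat_add_iff 1]
    simpa [sq] using h

theorem ae_energy_fourierSum (N : ℕ) :
    ∀ᵐ θ : ℝ, (3 / 2 * (expChar 1 θ + expChar (-1) θ) - 1) *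
      (fourierSum (fun t => (reflectionSeries N).coeff t) (fun t => -t) θ *
        fourierSum (fun t => (reflectionSeries N).coeff t) (fun t => t) θ) =
      fourierSum (fun t => (reflectionSeries N).coeff t) (fun t => t) θ +
        fourierSum (fun t => (reflectionSeries N).coeff t) (fun t => -t) θ := by
  have hs := summable_abs_coeff_reflectionSeries N
  filter_upwards [ae_aeval_exp_ne_zero (reflection_ne_zero N)] with θ hθ
  set z := Complex.exp (θ * Complex.I) with hzdef
  have hz0 : z ≠ 0 := Complex.exp_ne_zero _
  have hz : ‖z‖ = 1 := Complex.norm_exp_ofReal_mul_I θ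
  have hz' : ‖z⁻¹‖ = 1 := by rw [norm_inv, hz, inv_one]
  have hconj : (starRingEnd ℂ) z = z⁻¹ := by
    rw [Complex.inv_def, Complex.normSq_eq_norm_sq, hz]; simp
  have hθ' : Polynomial.aeval z⁻¹ (reflection N).2 ≠ 0 := by
    rw [← hconj, Polynomial.aeval_conj]
    simpa using hθ
  have e₁ : fourierSum (fun t => (reflectionSeries N).coeff t) (fun t => t) θ =
      ∑' t, ((reflectionSeries N).coeff t : ℂ) * z ^ t := by
    simp [fourierSum, expChar, hzdef]
  have e₂ : fourierSum (fun t => (reflectionSeries N).coeff t) (fun t => -t) θ =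
      ∑' t, ((reflectionSeries N).coeff t : ℂ) * z⁻¹ ^ t := by
    simp [fourierSum, expChar, hzdef]
  have e₃ : expChar 1 θ = z := by simp [expChar, hzdef]
  have e₄ : expChar (-1) θ = z⁻¹ := by simp [expChar, hzdef]
  have h₁ := aeval_mul_tsum_coeff hs (reflection_mul_reflectionSeries N) hz
  have h₂ := aeval_mul_tsum_coeff hs (reflection_mul_reflectionSeries N) hz'
  have h₃ := reflection_energy N (mul_inv_cancel₀ hz0)
  rw [e₁, e₂, e₃, e₄]
  rw [← h₁, ← h₂] at h₃
  refine mul_left_cancel₀ (mul_ne_zero hθ hθ') ?_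
  linear_combination h₃

/-- Numerator and denominator of the left absorption probability with right boundary at `N`. -/
def absorption : ℕ → ℝ × ℝ
  | 0 => (0, 1)
  | N + 1 => (2 * (absorption N).2 + 3 * (absorption N).1,
      3 * (absorption N).2 + 4 * (absorption N).1)

theorem absorption_pos (N : ℕ) : 0 ≤ (absorption N).1 ∧ 0 < (absorption N).2 := by
  induction N with
  | zero => simp [absorption]
  | succ N ih =>
    obtain ⟨h₁, h₂⟩ := ih
    constructor <;> simp only [absorption] <;> positivity

theorem aeval_reflection {w : ℂ} (hw : w ^ 2 = -2) (N : ℕ) :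
    Polynomial.aeval ((1 + 2 * w) / 3) (reflection N).1 =
        w * ((10 + 2 * w) / 9) ^ N * (absorption N).1 ∧
      Polynomial.aeval ((1 + 2 * w) / 3) (reflection N).2 =
        ((10 + 2 * w) / 9) ^ N * (absorption N).2 := by
  induction N with
  | zero => simp [reflection, absorption]
  | succ N ih =>
    obtain ⟨h₁, h₂⟩ := ih
    simp only [reflection, absorption, map_mul, map_add, map_sub, map_one, Polynomial.aeval_X,
      map_ofNat, h₁, h₂]
    push_cast
    rw [pow_succ ((10 + 2 * w) / 9) N]
    generalize ((10 + 2 * w) / 9) ^ N = m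
    generalize ((absorption N).1 : ℂ) = x
    generalize ((absorption N).2 : ℂ) = y
    have hw3 : w ^ 3 = -2 * w := by rw [pow_succ, hw]
    have hw4 : w ^ 4 = 4 := by rw [show w ^ 4 = (w ^ 2) ^ 2 by ring, hw]; norm_num
    constructor <;> ring_nf <;> simp only [hw, hw3, hw4] <;> ring

theorem leftAbsorbProb_eq (N : ℕ) :
    leftAbsorbProb 1 N 0 0 1 = (absorption N).1 / (absorption N).2 := by
  obtain ⟨-, hpos⟩ := absorption_pos N
  set w : ℂ := Real.sqrt 2 * Complex.I with hwdef
  have hw : w ^ 2 = -2 := by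
    rw [hwdef, mul_pow, Complex.I_sq, ← Complex.ofReal_pow, Real.sq_sqrt zero_le_two]
    push_cast; ring
  have hw0 : w ≠ 0 := fun h => by simp [h] at hw
  have hz : ‖(1 + 2 * w) / 3‖ = 1 := by
    have : ‖(1 + 2 * w) / 3‖ ^ 2 = 1 := by
      rw [Complex.sq_norm, Complex.normSq_apply]
      simp [hwdef]
      have := Real.mul_self_sqrt (zero_le_two (α := ℝ))
      linear_combination 4 / 9 * this
    exact (pow_eq_one_iff_of_nonneg (norm_nonneg _) two_ne_zero).1 this
  have hm : (10 + 2 * w) / 9 ≠ 0 := fun h => by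
    have := congrArg Complex.re h
    simp [hwdef] at this
  have hs := summable_abs_coeff_reflectionSeries N
  have h₁ := two_mul_tsum_eq hs (coeff_zero_reflectionSeries N) (ae_energy_fourierSum N) hz
    (by linear_combination 4 / 3 * hw)
  have h₂ := aeval_mul_tsum_coeff hs (reflection_mul_reflectionSeries N) hz
  rw [(aeval_reflection hw N).1, (aeval_reflection hw N).2] at h₂
  rw [← leftAbsorbProb_eq_autocorrelation] at h₁
  rw [eq_div_iff hpos.ne', ← Complex.ofReal_inj]
  push_cast
  refine mul_left_cancel₀ (mul_ne_zero (pow_ne_zero N hm) hw0) ?_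
  linear_combination h₂ - 1 / 2 * (((10 + 2 * w) / 9) ^ N * (absorption N).2) * h₁

theorem leftAbsorbProb_nonneg (N : ℕ) : 0 ≤ leftAbsorbProb 1 N 0 0 1 := by
  rw [leftAbsorbProb_eq]
  exact div_nonneg (absorption_pos N).1 (absorption_pos N).2.le

theorem leftAbsorbProb_succ (N : ℕ) : leftAbsorbProb 1 (N + 1) 0 0 1 =
    (2 + 3 * leftAbsorbProb 1 N 0 0 1) / (3 + 4 * leftAbsorbProb 1 N 0 0 1) := by
  obtain ⟨h₁, h₂⟩ := absorption_pos N
  rw [leftAbsorbProb_eq, leftAbsorbProb_eq, absorption]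
  field_simp

end GroverWalk

/-- Every nonnegative orbit of `p ↦ (2 + 3 p) / (3 + 4 p)` converges to the positive fixed
point. -/
theorem tendsto_of_moebius_recurrence {p : ℕ → ℝ} (hp : ∀ n, 0 ≤ p n)
    (h : ∀ n, p (n + 1) = (2 + 3 * p n) / (3 + 4 * p n)) :
    Tendsto p atTop (𝓝 (1 / Real.sqrt 2)) := by
  set s := 1 / Real.sqrt 2 with hs
  have hs2 : 2 * s ^ 2 = 1 := by
    rw [hs, div_pow, Real.sq_sqrt zero_le_two]; norm_num
  have hs0 : 0 < s := by positivity
  have hs3 : |3 - 4 * s| ≤ 1 := by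
    rw [abs_le]; constructor <;> nlinarith
  have key : ∀ n, |p n - s| ≤ |p 0 - s| * (1 / 3) ^ n := fun n => by
    induction n with
    | zero => simp
    | succ n ih =>
      have hd : 0 < 3 + 4 * p n := by linarith [hp n]
      have e : p (n + 1) - s = (p n - s) * (3 - 4 * s) / (3 + 4 * p n) := by
        rw [h, div_sub' hd.ne']
        congr 1
        linear_combination -2 * hs2
      rw [e, abs_div, abs_mul, abs_of_pos hd, div_le_iff₀ hd]
      calc |p n - s| * |3 - 4 * s| ≤ |p n - s| * 1 := by gcongr
        _ ≤ |p 0 - s| * (1 / 3) ^ n := by rw [mul_one]; exact ih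
        _ = |p 0 - s| * (1 / 3) ^ (n + 1) * 3 := by ring
        _ ≤ _ := by gcongr; linarith [hp n]
  rw [tendsto_iff_norm_sub_tendsto_zero]
  refine squeeze_zero (fun _ => norm_nonneg _) key ?_
  simpa using (tendsto_pow_atTop_nhds_zero_of_lt_one (r := (1 / 3 : ℝ)) (by norm_num)
    (by norm_num)).const_mul |p 0 - s|

end

theorem theorem4 :
    (∀ N : ℕ, Summable (GroverWalk.leftHitProb 1 N 0 0 1)) ∧
    GroverWalk.leftAbsorbProb 1 0 0 0 1 = 0 ∧
    (∀ N : ℕ, GroverWalk.leftAbsorbProb 1 (N + 1) 0 0 1 =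
      (2 + 3 * GroverWalk.leftAbsorbProb 1 N 0 0 1) /
        (3 + 4 * GroverWalk.leftAbsorbProb 1 N 0 0 1)) ∧
    Filter.Tendsto (fun N : ℕ => GroverWalk.leftAbsorbProb 1 N 0 0 1) Filter.atTop
      (nhds (1 / Real.sqrt 2)) := by
  refine ⟨fun N => GroverWalk.summable_leftHitProb 1 N 0 0 1, ?_, GroverWalk.leftAbsorbProb_succ,
    tendsto_of_moebius_recurrence GroverWalk.leftAbsorbProb_nonneg
      GroverWalk.leftAbsorbProb_succ⟩
  rw [GroverWalk.leftAbsorbProb_eq, GroverWalk.absorption, zero_div]
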